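/- Let $Fm$ be the set of formulas over a countably infinite set of variables in the language $\{\land,\lor,\otimes,\oplus,\supset,\neg\}$; write $p\to q$ for $(p\supset q)\land(\neg q\supset\neg p)$, $p\leftrightarrow q$ for $(p\to q)\land(q\to p)$ and $p\equiv q$ for $(p\supset q)\land(q\supset p)$. A bilattice is an algebra $\langle B,\land,\lor,\otimes,\oplus,\neg\rangle$ such that $\langle B,\land,\lor\rangle$ and $\langle B,\otimes,\oplus\rangle$ are lattices, with orders $\le_t$ and $\le_k$, and $\neg$ reverses $\le_t$, preserves $\le_k$ and satisfies $\neg\neg a=a$. A prime bifilter is a non-empty proper subset $F\subsetneq B$ such that $a\land b\in F$ iff $a\otimes b\in F$ iff ($a\in F$ and $b\in F$), and $a\lor b\in F$ iff $a\oplus b\in F$ iff ($a\in F$ or $b\in F$). The logic $\mathcal{LB}_\supset$ is defined by: $\Gamma\vDash\varphi$ iff, for every bilattice $B$ with a $\le_t$-greatest element $\mathsf t$, every prime bifilter $F$ of $B$, and every homomorphism $h$ from the formula algebra into $B$ expanded by the operation $a\supset b:=b$ if $a\in F$, $a\supset b:=\mathsf t$ if $a\notin F$, one has $h(\varphi)\in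 F$ whenever $h[\Gamma]\subseteq F$. The logic $H_\supset$ is given by the Hilbert-style calculus with modus ponens (from $p$ and $p\supset q$ infer $q$) as the only rule and all instances of the axioms $p\supset(q\supset p)$; $(p\supset(q\supset r))\supset((p\supset q)\supset(p\supset r))$; $((p\supset q)\supset p)\supset p$; $(p\bullet q)\supset p$, $(p\bullet q)\supset q$ and $p\supset(q\supset(p\bullet q))$ for $\bullet\in\{\land,\otimes\}$; $p\supset(p\circ q)$, $q\supset(p\circ q)$ and $(p\supset r)\supset((q\supset r)\supset((p\circ q)\supset r))$ for $\circ\in\{\lor,\oplus\}$; $\neg(p\land q)\equiv(\neg p\lor\neg q)$; $\neg(p\lor q)\equiv(\neg p\land\neg q)$; $\neg(p\otimes q)\equiv(\neg p\otimes\neg q)$; $\neg(p\oplus q)\equiv(\neg p\oplus\neg q)$; $\neg(p\supset q)\equiv(p\land\neg q)$; $p\equiv\neg\neg p$. An implicative bilattice is an algebra $\langle B,\land,\lor,\otimes,\oplus,\supset,\neg\rangle$ whose $\supset$-free reduct is a bilattice and which satisfies (IB1) $(x\supset x)\supset y\approx y$; (IB2) $x\supset(y\supset z)\approx(x\land y)\supset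 z\approx(x\otimes y)\supset z$; (IB3) $((x\supset y)\supset x)\supset x\approx x\supset x$; (IB4) $(x\lor y)\supset z\approx(x\supset z)\land(y\supset z)\approx(x\oplus y)\supset z$; (IB5) $x\land((x\supset y)\supset(x\otimes y))\approx x$; (IB6) $\neg(x\supset y)\supset z\approx(x\land\neg y)\supset z$. Let $\mathsf{ImpBiLat}$ be the class of implicative bilattices. A finitary logic $\vdash$ is algebraizable (in the sense of Blok and Pigozzi) with equivalent algebraic semantics $\mathsf K$, a finite set $\tau(p)$ of defining equations and a finite set $\Delta(p,q)$ of equivalence formulas if, for all $\Gamma\cup\{\varphi,\psi\}\subseteq Fm$: $\Gamma\vdash\varphi$ iff $\bigcup_{\gamma\in\Gamma}\tau(\gamma)\models_{\mathsf K}\tau(\varphi)$; and $\varphi\approx\psi$ and $\bigcup_{\chi\in\Delta(\varphi,\psi)}\tau(\chi)$ are equivalent with respect to $\models_{\mathsf K}$, where $\models_{\mathsf K}$ is the equational consequence of $\mathsf K$. A matrix $\langle A,F\rangle$ is a model of the logic if $\Gamma\vdash\varphi$ implies $h(\varphi)\in F$ for every homomorphism $h$ from the formula algebra to $A$ with $h[\Gamma]\subseteq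 F$, and it is reduced if the identity is the only congruence of $A$ compatible with $F$. Theorem. (1) The logics $H_\supset$ and $\mathcal{LB}_\supset$ are algebraizable with equivalent algebraic semantics $\mathsf{ImpBiLat}$, the single defining equation $\varphi\approx\varphi\supset\varphi$ and the single equivalence formula $\varphi\leftrightarrow\psi$. (2) $\mathsf{ImpBiLat}$ is a variety, and it is the only quasivariety that is an equivalent algebraic semantics of $\mathcal{LB}_\supset$ (for any choice of defining equations and equivalence formulas). (3) $\mathsf{ImpBiLat}$ is the class $\mathbf{Alg}^*\mathcal{LB}_\supset$ of the algebraic reducts of the reduced models of $\mathcal{LB}_\supset$. -/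

import Mathlib

universe u v

/-! ## Formulas and equations -/

/-- Formulas (terms) over the set of variables `V` in the language `{∧, ∨, ⊗, ⊕, ⊃, ¬}`. -/
inductive Fm (V : Type) : Type
  | var : V → Fm V
  | meet : Fm V → Fm V → Fm V
  | join : Fm V → Fm V → Fm V
  | tensor : Fm V → Fm V → Fm V
  | plus : Fm V → Fm V → Fm V
  | imp : Fm V → Fm V → Fm V
  | neg : Fm V → Fm V

namespace Fm

/-- The homomorphism of formula algebras that extends `σ`. -/
def subst {V W : Type} (σ : V → Fm W) : Fm V → Fm W
  | var p => σ p
  | meet a b => meet (subst σ a) (subst σ b)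
  | join a b => join (subst σ a) (subst σ b)
  | tensor a b => tensor (subst σ a) (subst σ b)
  | plus a b => plus (subst σ a) (subst σ b)
  | imp a b => imp (subst σ a) (subst σ b)
  | neg a => neg (subst σ a)

/-- `p ≡ q`, that is `(p ⊃ q) ∧ (q ⊃ p)`. -/
def weakEquiv {V : Type} (p q : Fm V) : Fm V := (p.imp q).meet (q.imp p)

/-- Strong implication `p → q`, that is `(p ⊃ q) ∧ (¬q ⊃ ¬p)`. -/
def strongImp {V : Type} (p q : Fm V) : Fm V := (p.imp q).meet (q.neg.imp p.neg)

/-- Strong equivalence `p ↔ q`, that is `(p → q) ∧ (q → p)`. -/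
def strongIff {V : Type} (p q : Fm V) : Fm V := (p.strongImp q).meet (q.strongImp p)

end Fm

/-- An equation `φ ≈ ψ` is a pair of formulas. -/
abbrev FmEq (V : Type) : Type := Fm V × Fm V

/-! ## Algebras of the similarity type `{∧, ∨, ⊗, ⊕, ⊃, ¬}` -/

/-- An arbitrary (non-empty) algebra of the similarity type `{∧, ∨, ⊗, ⊕, ⊃, ¬}`. -/
structure BAlg : Type (u + 1) where
  carrier : Type u
  inhabited : Nonempty carrier
  meet : carrier → carrier → carrier
  join : carrier → carrier → carrier
  tensor : carrier → carrier → carrier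
  plus : carrier → carrier → carrier
  imp : carrier → carrier → carrier
  neg : carrier → carrier

instance : CoeSort BAlg.{u} (Type u) := ⟨BAlg.carrier⟩

/-- The value of a formula under the homomorphism from the formula algebra to `A` that extends
`h`; every homomorphism is of this form for exactly one `h`. -/
def Fm.eval {V : Type} (A : BAlg.{u}) (h : V → A) : Fm V → A
  | var p => h p
  | meet a b => A.meet (eval A h a) (eval A h b)
  | join a b => A.join (eval A h a) (eval A h b)
  | tensor a b => A.tensor (eval A h a) (eval A h b)
  | plus a b => A.plus (eval A h a) (eval A h b)
  | imp a b => A.imp (eval A h a) (eval A h b)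
  | neg a => A.neg (eval A h a)

theorem Fm.eval_subst {V W : Type} (A : BAlg.{u}) (h : W → A) (σ : V → Fm W) (a : Fm V) :
    (a.subst σ).eval A h = a.eval A (fun p => (σ p).eval A h) := by
  induction a <;> simp_all [Fm.subst, Fm.eval]

/-- The equation `e` holds in `A` under the valuation `h`. -/
def FmEq.Holds {V : Type} (e : FmEq V) (A : BAlg.{u}) (h : V → A) : Prop :=
  e.1.eval A h = e.2.eval A h

/-- The equational consequence relation of the class of algebras `K`. -/
def EqConsequence (K : Set BAlg.{u}) (E : Set (FmEq ℕ)) (e : FmEq ℕ) : Prop :=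
  ∀ A ∈ K, ∀ h : ℕ → A, (∀ d ∈ E, d.Holds A h) → e.Holds A h

/-- `K` is a variety: the class of all algebras that satisfy some set of identities. -/
def IsVariety (K : Set BAlg.{u}) : Prop :=
  ∃ E : Set (FmEq ℕ), ∀ A : BAlg.{u}, A ∈ K ↔ ∀ e ∈ E, ∀ h : ℕ → A, e.Holds A h

/-- `K` is a quasivariety: the class of all algebras that satisfy some set of quasi-identities
`e₁ & … & eₙ ⇒ e`. -/
def IsQuasivariety (K : Set BAlg.{u}) : Prop :=
  ∃ Q : Set (List (FmEq ℕ) × FmEq ℕ), ∀ A : BAlg.{u},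
    A ∈ K ↔ ∀ q ∈ Q, ∀ h : ℕ → A, (∀ d ∈ q.1, d.Holds A h) → q.2.Holds A h

/-! ## Bilattices and implicative bilattices -/

/-- `⟨X, meet, join⟩` is a lattice. -/
structure IsLatticeOps {X : Type u} (meet join : X → X → X) : Prop where
  meet_comm : ∀ a b, meet a b = meet b a
  meet_assoc : ∀ a b c, meet (meet a b) c = meet a (meet b c)
  join_comm : ∀ a b, join a b = join b a
  join_assoc : ∀ a b c, join (join a b) c = join a (join b c)
  meet_join_self : ∀ a b, meet a (join a b) = a
  join_meet_self : ∀ a b, join a (meet a b) = a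

namespace BAlg

/-- The truth order. -/
def LeT (A : BAlg.{u}) (a b : A) : Prop := A.meet a b = a

/-- The knowledge order. -/
def LeK (A : BAlg.{u}) (a b : A) : Prop := A.tensor a b = a

/-- The reduct `⟨A, ∧, ∨, ⊗, ⊕, ¬⟩` is a bilattice. -/
structure IsBilattice (A : BAlg.{u}) : Prop where
  truth_lattice : IsLatticeOps A.meet A.join
  knowledge_lattice : IsLatticeOps A.tensor A.plus
  neg1 : ∀ a b, A.LeT a b → A.LeT (A.neg b) (A.neg a)
  neg2 : ∀ a b, A.LeK a b → A.LeK (A.neg a) (A.neg b)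
  neg3 : ∀ a, a = A.neg (A.neg a)

/-- Implicative bilattices. -/
structure IsImplicativeBilattice (A : BAlg.{u}) : Prop where
  bilattice : A.IsBilattice
  ib1 : ∀ x y, A.imp (A.imp x x) y = y
  ib2 : ∀ x y z, A.imp x (A.imp y z) = A.imp (A.meet x y) z ∧
    A.imp (A.meet x y) z = A.imp (A.tensor x y) z
  ib3 : ∀ x y, A.imp (A.imp (A.imp x y) x) x = A.imp x x
  ib4 : ∀ x y z, A.imp (A.join x y) z = A.meet (A.imp x z) (A.imp y z) ∧
    A.meet (A.imp x z) (A.imp y z) = A.imp (A.plus x y) z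
  ib5 : ∀ x y, A.meet x (A.imp (A.imp x y) (A.tensor x y)) = x
  ib6 : ∀ x y z, A.imp (A.neg (A.imp x y)) z = A.imp (A.meet x (A.neg y)) z

/-- `F` is a prime bifilter of the bilattice reduct of `A`: a non-empty proper subset that is a
prime filter of both lattices. -/
structure IsPrimeBifilter (A : BAlg.{u}) (F : Set A) : Prop where
  nonempty : F.Nonempty
  proper : F ≠ Set.univ
  meet_mem : ∀ a b, A.meet a b ∈ F ↔ a ∈ F ∧ b ∈ F
  tensor_mem : ∀ a b, A.tensor a b ∈ F ↔ a ∈ F ∧ b ∈ F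
  join_mem : ∀ a b, A.join a b ∈ F ↔ a ∈ F ∨ b ∈ F
  plus_mem : ∀ a b, A.plus a b ∈ F ↔ a ∈ F ∨ b ∈ F

/-- `⟨A, F⟩` is a logical bilattice (a bilattice with a prime bifilter) that has a maximum `t` of
the truth order, enriched with the implication `a ⊃ b = b` if `a ∈ F`, and `a ⊃ b = t` if
`a ∉ F`. -/
structure IsLogicalBilatticeImp (A : BAlg.{u}) (F : Set A) : Prop where
  bilattice : A.IsBilattice
  prime : A.IsPrimeBifilter F
  imp_spec : ∃ t : A, (∀ a, A.LeT a t) ∧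
    ∀ a b, (a ∈ F → A.imp a b = b) ∧ (a ∉ F → A.imp a b = t)

end BAlg

/-- The class of implicative bilattices. -/
def ImpBiLat : Set BAlg.{u} := {A | A.IsImplicativeBilattice}

/-! ## Sentential logics -/

/-- A sentential logic: a consequence relation on the formulas over a countably infinite set of
variables (the relation of a closure operator) that is invariant under substitutions. -/
structure SententialLogic where
  Entails : Set (Fm ℕ) → Fm ℕ → Prop
  refl : ∀ Γ φ, φ ∈ Γ → Entails Γ φ
  cut : ∀ Γ Δ φ, (∀ ψ ∈ Δ, Entails Γ ψ) → Entails Δ φ → Entails Γ φ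
  structural : ∀ (σ : ℕ → Fm ℕ) (Γ : Set (Fm ℕ)) (φ : Fm ℕ),
    Entails Γ φ → Entails (Fm.subst σ '' Γ) (φ.subst σ)

/-- The consequence relation of the matrix `⟨A, F⟩`. -/
def MatrixEntails (A : BAlg.{u}) (F : Set A) (Γ : Set (Fm ℕ)) (φ : Fm ℕ) : Prop :=
  ∀ h : ℕ → A, (∀ ψ ∈ Γ, ψ.eval A h ∈ F) → φ.eval A h ∈ F

/-- The logic `LB⊃`: truth preservation in all logical bilattices with Arieli–Avron's implication
(with carriers in `Type v`). -/
def LBImpLogic : SententialLogic where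
  Entails Γ φ := ∀ (A : BAlg.{v}) (F : Set A), A.IsLogicalBilatticeImp F → MatrixEntails A F Γ φ
  refl _ φ hφ _ _ _ _ hΓ := hΓ φ hφ
  cut _ _ _ hΔ hφ A F hA h hΓ := hφ A F hA h fun ψ hψ => hΔ ψ hψ A F hA h hΓ
  structural σ Γ φ hφ A F hA h hΓ := by
    rw [Fm.eval_subst]
    refine hφ A F hA _ fun ψ hψ => ?_
    rw [← Fm.eval_subst]
    exact hΓ _ ⟨ψ, hψ, rfl⟩

/-- The axioms of the Hilbert-style calculus `H⊃`. -/
inductive HAxiom : Fm ℕ → Prop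
  | imp1 (p q : Fm ℕ) : HAxiom (p.imp (q.imp p))
  | imp2 (p q r : Fm ℕ) :
      HAxiom ((p.imp (q.imp r)).imp ((p.imp q).imp (p.imp r)))
  | imp3 (p q : Fm ℕ) : HAxiom (((p.imp q).imp p).imp p)
  | meet_imp_left (p q : Fm ℕ) : HAxiom ((p.meet q).imp p)
  | meet_imp_right (p q : Fm ℕ) : HAxiom ((p.meet q).imp q)
  | imp_meet (p q : Fm ℕ) : HAxiom (p.imp (q.imp (p.meet q)))
  | tensor_imp_left (p q : Fm ℕ) : HAxiom ((p.tensor q).imp p)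
  | tensor_imp_right (p q : Fm ℕ) : HAxiom ((p.tensor q).imp q)
  | imp_tensor (p q : Fm ℕ) : HAxiom (p.imp (q.imp (p.tensor q)))
  | imp_join_left (p q : Fm ℕ) : HAxiom (p.imp (p.join q))
  | imp_join_right (p q : Fm ℕ) : HAxiom (q.imp (p.join q))
  | join_imp (p q r : Fm ℕ) :
      HAxiom ((p.imp r).imp ((q.imp r).imp ((p.join q).imp r)))
  | imp_plus_left (p q : Fm ℕ) : HAxiom (p.imp (p.plus q))
  | imp_plus_right (p q : Fm ℕ) : HAxiom (q.imp (p.plus q))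
  | plus_imp (p q r : Fm ℕ) :
      HAxiom ((p.imp r).imp ((q.imp r).imp ((p.plus q).imp r)))
  | neg_meet (p q : Fm ℕ) : HAxiom ((p.meet q).neg.weakEquiv (p.neg.join q.neg))
  | neg_join (p q : Fm ℕ) : HAxiom ((p.join q).neg.weakEquiv (p.neg.meet q.neg))
  | neg_tensor (p q : Fm ℕ) : HAxiom ((p.tensor q).neg.weakEquiv (p.neg.tensor q.neg))
  | neg_plus (p q : Fm ℕ) : HAxiom ((p.plus q).neg.weakEquiv (p.neg.plus q.neg))
  | neg_imp (p q : Fm ℕ) : HAxiom ((p.imp q).neg.weakEquiv (p.meet q.neg))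
  | neg_neg (p : Fm ℕ) : HAxiom (p.weakEquiv p.neg.neg)

/-- Derivability in `H⊃`, with modus ponens as the only rule. -/
inductive HDerives (Γ : Set (Fm ℕ)) : Fm ℕ → Prop
  | ax (φ : Fm ℕ) : HAxiom φ → HDerives Γ φ
  | hyp (φ : Fm ℕ) : φ ∈ Γ → HDerives Γ φ
  | mp (φ ψ : Fm ℕ) : HDerives Γ φ → HDerives Γ (φ.imp ψ) → HDerives Γ ψ

theorem HAxiom.subst (σ : ℕ → Fm ℕ) {φ : Fm ℕ} (h : HAxiom φ) : HAxiom (φ.subst σ) := by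
  cases h <;> simp only [Fm.subst, Fm.weakEquiv] <;> constructor

/-- The logic `H⊃`. -/
def HImpLogic : SententialLogic where
  Entails := HDerives
  refl _ φ hφ := .hyp φ hφ
  cut Γ Δ φ hΔ hφ := by
    induction hφ with
    | ax φ h => exact .ax φ h
    | hyp φ h => exact hΔ φ h
    | mp φ ψ _ _ h₁ h₂ => exact .mp φ ψ h₁ h₂
  structural σ Γ φ hφ := by
    induction hφ with
    | ax φ h => exact .ax _ (h.subst σ)
    | hyp φ h => exact .hyp _ ⟨φ, h, rfl⟩
    | mp φ ψ _ _ h₁ h₂ => exact .mp _ _ h₁ h₂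

namespace SententialLogic

/-- `L` is finitary. -/
def Finitary (L : SententialLogic) : Prop :=
  ∀ Γ φ, L.Entails Γ φ → ∃ Γ₀ ⊆ Γ, Γ₀.Finite ∧ L.Entails Γ₀ φ

/-- `⟨A, F⟩` is a model of `L` (`F` is an `L`-filter on `A`). -/
def IsModel (L : SententialLogic) (A : BAlg.{u}) (F : Set A) : Prop :=
  ∀ Γ φ, L.Entails Γ φ → MatrixEntails A F Γ φ

end SententialLogic

/-! ## Reduced models -/

/-- `θ` is a congruence of the algebra `A`. -/
structure BAlg.IsCongruence (A : BAlg.{u}) (θ : A → A → Prop) : Prop where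
  equivalence : Equivalence θ
  meet : ∀ a b c d, θ a b → θ c d → θ (A.meet a c) (A.meet b d)
  join : ∀ a b c d, θ a b → θ c d → θ (A.join a c) (A.join b d)
  tensor : ∀ a b c d, θ a b → θ c d → θ (A.tensor a c) (A.tensor b d)
  plus : ∀ a b c d, θ a b → θ c d → θ (A.plus a c) (A.plus b d)
  imp : ∀ a b c d, θ a b → θ c d → θ (A.imp a c) (A.imp b d)
  neg : ∀ a b, θ a b → θ (A.neg a) (A.neg b)

/-- The matrix `⟨A, F⟩` is reduced: its Leibniz congruence, the greatest congruence compatible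
with `F`, is the identity; that is, the identity is the only congruence compatible with `F`. -/
def BAlg.IsReduced (A : BAlg.{u}) (F : Set A) : Prop :=
  ∀ θ : A → A → Prop, A.IsCongruence θ → (∀ a b, θ a b → a ∈ F → b ∈ F) →
    ∀ a b, θ a b → a = b

/-- `Alg* L`: the algebraic reducts of the reduced models of `L`. -/
def AlgStar (L : SententialLogic) : Set BAlg.{u} :=
  {A | ∃ F : Set A, L.IsModel A F ∧ A.IsReduced F}

/-! ## Algebraizability in the sense of Blok and Pigozzi -/

/-- The set of equations `τ(φ)`, for a finite set `τ` of equations in one variable. -/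
def defEqs (τ : Finset (FmEq (Fin 1))) (φ : Fm ℕ) : Set (FmEq ℕ) :=
  {e | ∃ d ∈ τ, e = (d.1.subst (fun _ => φ), d.2.subst (fun _ => φ))}

/-- The set of formulas `Δ(φ, ψ)`, for a finite set `Δ` of formulas in two variables. -/
def eqvFms (Δ : Finset (Fm (Fin 2))) (φ ψ : Fm ℕ) : Set (Fm ℕ) :=
  {χ | ∃ δ ∈ Δ, χ = δ.subst ![φ, ψ]}

/-- The finitary logic `L` is algebraizable with equivalent algebraic semantics `K`, defining
equations `τ` and equivalence formulas `Δ`. -/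
structure IsEquivalentAlgebraicSemantics (L : SententialLogic) (K : Set BAlg.{u})
    (τ : Finset (FmEq (Fin 1))) (Δ : Finset (Fm (Fin 2))) : Prop where
  finitary : L.Finitary
  /-- `Γ ⊢ φ` iff `τ(Γ) ⊨ τ(φ)` over `K`. -/
  entails_iff : ∀ (Γ : Set (Fm ℕ)) (φ : Fm ℕ), L.Entails Γ φ ↔
    ∀ e ∈ defEqs τ φ, EqConsequence K (⋃ γ ∈ Γ, defEqs τ γ) e
  /-- `φ ≈ ψ ⊨ τ(Δ(φ, ψ))` over `K`. -/
  eqv_of_eq : ∀ φ ψ : Fm ℕ, ∀ e ∈ ⋃ χ ∈ eqvFms Δ φ ψ, defEqs τ χ,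
    EqConsequence K {(φ, ψ)} e
  /-- `τ(Δ(φ, ψ)) ⊨ φ ≈ ψ` over `K`. -/
  eq_of_eqv : ∀ φ ψ : Fm ℕ, EqConsequence K (⋃ χ ∈ eqvFms Δ φ ψ, defEqs τ χ) (φ, ψ)

/-- The single defining equation `p ≈ p ⊃ p`. -/
def tauImp : Finset (FmEq (Fin 1)) := {(.var 0, (Fm.var 0).imp (.var 0))}

/-- The single equivalence formula `p ↔ q`. -/
def deltaImp : Finset (Fm (Fin 2)) := {(Fm.var 0).strongIff (.var 1)}

/-! ## Bilattices -/

/-! Everything reduces to the four-element matrix with its designated set. The axioms of `H⊃` hold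
in every logical bilattice because membership in a prime bifilter turns them into classical
tautologies. Conversely, if `H⊃` does not derive φ from Γ, a maximal theory T ⊇ Γ not deriving φ
yields the valuation p ↦ (p ∈ T, ¬p ∈ T) into the four-element bilattice, which refutes the
inference. Since that bilattice is itself a logical bilattice, `H⊃` and `LB⊃` coincide.

In an implicative bilattice let D be the set of solutions of a = a ⊃ a. D contains the values of all
axioms and is closed under modus ponens. By (IB5), a ⊃ b ∈ D gives a ≤_t a ⊗ b; together with ¬b ⊃
¬a ∈ D this gives a ≤_t b (`leT_of_imp_mem`), so a ↔ b ∈ D iff a = b. With completeness for the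
four-element algebra, which is an implicative bilattice, this is algebraizability.

The logic determines the equational consequence of any equivalent semantics, since all sets of
equivalence formulas are interderivable; hence uniqueness among quasivarieties. In a model ⟨A, F⟩, a
↔ b ∈ F defines a congruence compatible with F. If the model is reduced, this congruence is the
identity, and A satisfies every identity of the class, so it belongs to the class. -/

namespace IsLatticeOps

variable {X : Type u} {m j : X → X → X}

theorem meet_self (h : IsLatticeOps m j) (a : X) : m a a = a := by
  conv_lhs => rw [← h.join_meet_self a a, h.join_meet_self a a]
  have := h.meet_join_self a (m a a)
  rwa [h.join_meet_self] at this

theorem join_eq_of_meet_eq (h : IsLatticeOps m j) {a b : X} (hab : m a b = a) : j a b = b := by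
  have := h.join_meet_self b a
  rwa [h.meet_comm, hab, h.join_comm] at this

theorem meet_eq_of_join_eq (h : IsLatticeOps m j) {a b : X} (hab : j a b = b) : m a b = a := by
  rw [← hab, h.meet_join_self]

theorem meet_meet_left (h : IsLatticeOps m j) (a b : X) : m (m a b) a = m a b := by
  rw [h.meet_comm a b, h.meet_assoc, h.meet_self]

theorem meet_meet_right (h : IsLatticeOps m j) (a b : X) : m (m a b) b = m a b := by
  rw [h.meet_assoc, h.meet_self]

theorem dual (h : IsLatticeOps m j) : IsLatticeOps j m :=
  ⟨h.join_comm, h.join_assoc, h.meet_comm, h.meet_assoc, h.join_meet_self, h.meet_join_self⟩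

theorem le_meet (h : IsLatticeOps m j) {a b c : X} (hb : m c b = c) (ha : m c a = c) :
    m c (m a b) = c := by
  rw [← h.meet_assoc, ha, hb]

theorem antisymm (h : IsLatticeOps m j) {a b : X} (hab : m a b = a) (hba : m b a = b) : a = b := by
  rw [← hab, h.meet_comm, hba]

theorem le_join_left (h : IsLatticeOps m j) (a b : X) : m a (j a b) = a := h.meet_join_self a b

theorem le_join_right (h : IsLatticeOps m j) (a b : X) : m b (j a b) = b := by
  rw [h.join_comm, h.meet_join_self]

/-- An order-preserving involution of a lattice is a homomorphism for the meet. -/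
theorem map_meet_of_involutive {m' j' : X → X → X} (h : IsLatticeOps m j) (h' : IsLatticeOps m' j')
    {f : X → X} (hf : ∀ a b, m a b = a → m' (f a) (f b) = f a)
    (hf' : ∀ a b, m' a b = a → m (f a) (f b) = f a) (hff : ∀ a, a = f (f a)) (a b : X) :
    f (m a b) = m' (f a) (f b) := by
  refine h'.antisymm
    (h'.le_meet (hf _ _ (h.meet_meet_right a b)) (hf _ _ (h.meet_meet_left a b))) ?_
  -- Reverse inequality: `f` sends the meet of `f a` and `f b` below both `a` and `b`; applying `f`
  -- again and cancelling the involution gives the claim.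
  have key : m (f (m' (f a) (f b))) (m a b) = f (m' (f a) (f b)) := by
    refine h.le_meet ?_ ?_
    · conv_lhs => rw [hff b]
      rw [← hff b]
      conv_lhs => arg 2; rw [hff b]
      exact hf' _ _ (h'.meet_meet_right _ _)
    · conv_lhs => arg 2; rw [hff a]
      exact hf' _ _ (h'.meet_meet_left _ _)
  have := hf _ _ key
  rwa [← hff] at this

end IsLatticeOps

namespace BAlg

namespace IsBilattice

variable {A : BAlg.{u}}

/-- Negation is antitone for the truth order, so it is order-preserving into the dual lattice. -/
theorem neg_meet (h : A.IsBilattice) (a b : A) :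
    A.neg (A.meet a b) = A.join (A.neg a) (A.neg b) := by
  have ht := h.truth_lattice
  refine ht.map_meet_of_involutive ht.dual (fun x y hxy => ?_) (fun x y hxy => ?_) h.neg3 a b
  · rw [ht.join_comm]
    exact ht.join_eq_of_meet_eq (h.neg1 _ _ hxy)
  · have hyx : A.meet y x = y := ht.meet_eq_of_join_eq (by rw [ht.join_comm, hxy])
    exact h.neg1 _ _ hyx

theorem neg_join (h : A.IsBilattice) (a b : A) :
    A.neg (A.join a b) = A.meet (A.neg a) (A.neg b) := by
  rw [h.neg3 (A.meet _ _), h.neg_meet, ← h.neg3, ← h.neg3]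

theorem neg_tensor (h : A.IsBilattice) (a b : A) :
    A.neg (A.tensor a b) = A.tensor (A.neg a) (A.neg b) :=
  h.knowledge_lattice.map_meet_of_involutive h.knowledge_lattice h.neg2 h.neg2 h.neg3 a b

theorem neg_plus (h : A.IsBilattice) (a b : A) :
    A.neg (A.plus a b) = A.plus (A.neg a) (A.neg b) := by
  have hk := h.knowledge_lattice
  have hf : ∀ a b, A.plus a b = a → A.plus (A.neg a) (A.neg b) = A.neg a := fun x y hxy => by
    rw [hk.join_comm]
    exact hk.join_eq_of_meet_eq (h.neg2 _ _ (hk.meet_eq_of_join_eq (by rw [hk.join_comm, hxy])))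
  exact hk.dual.map_meet_of_involutive hk.dual hf hf h.neg3 a b

end IsBilattice

/-- The set of designated elements, the solutions of `a = a ⊃ a`. -/
def designated (A : BAlg.{u}) : Set A := {a | a = A.imp a a}

/-! ### The designated filter of an implicative bilattice -/

namespace IsImplicativeBilattice

variable {A : BAlg.{u}}

/-- (IB1) lets a designated antecedent be erased, so that membership proofs become rewriting. -/
theorem mem_designated_iff (hA : A.IsImplicativeBilattice) {a : A} :
    a ∈ A.designated ↔ ∀ z, A.imp a z = z := by
  refine ⟨fun h z => ?_, fun h => (h a).symm⟩
  have h : a = A.imp a a := h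
  rw [h, hA.ib1]

theorem imp_self_mem (hA : A.IsImplicativeBilattice) (a : A) : A.imp a a ∈ A.designated :=
  hA.mem_designated_iff.2 (hA.ib1 a)

theorem imp_imp (hA : A.IsImplicativeBilattice) (x y z : A) :
    A.imp x (A.imp y z) = A.imp (A.meet x y) z := (hA.ib2 x y z).1

theorem imp_imp_tensor (hA : A.IsImplicativeBilattice) (x y z : A) :
    A.imp x (A.imp y z) = A.imp (A.tensor x y) z := (hA.ib2 x y z).1.trans (hA.ib2 x y z).2

theorem imp_left_comm (hA : A.IsImplicativeBilattice) (x y z : A) :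
    A.imp x (A.imp y z) = A.imp y (A.imp x z) := by
  rw [hA.imp_imp, hA.imp_imp, hA.bilattice.truth_lattice.meet_comm]

theorem imp_imp_self (hA : A.IsImplicativeBilattice) (x y : A) :
    A.imp x (A.imp x y) = A.imp x y := by
  rw [hA.imp_imp, hA.bilattice.truth_lattice.meet_self]

theorem meet_mem_designated (hA : A.IsImplicativeBilattice) {a b : A} :
    A.meet a b ∈ A.designated ↔ a ∈ A.designated ∧ b ∈ A.designated := by
  simp only [hA.mem_designated_iff, ← hA.imp_imp]
  refine ⟨fun h => ⟨fun z => ?_, fun z => ?_⟩, fun h z => by rw [h.2, h.1]⟩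
  · rw [← h z, hA.imp_imp_self]
  · rw [← h z, hA.imp_left_comm b, hA.imp_imp_self]

theorem mem_of_leT (hA : A.IsImplicativeBilattice) {a b : A} (ha : a ∈ A.designated)
    (hab : A.LeT a b) : b ∈ A.designated := by
  rw [← show A.meet a b = a from hab] at ha
  exact (hA.meet_mem_designated.1 ha).2

theorem mem_of_imp_mem (hA : A.IsImplicativeBilattice) {a b : A} (ha : a ∈ A.designated)
    (hab : A.imp a b ∈ A.designated) : b ∈ A.designated := by
  rwa [hA.mem_designated_iff.1 ha] at hab

/-- For designated `b`, Peirce's law (IB3) collapses to (a ⊃ b) ⊃ b = b; exchanging antecedents then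
turns (a ⊃ b) ⊃ (a ⊃ b) into a ⊃ b. -/
theorem imp_mem_of_mem (hA : A.IsImplicativeBilattice) (a : A) {b : A} (hb : b ∈ A.designated) :
    A.imp a b ∈ A.designated := by
  have h : A.imp (A.imp a b) b = b := by
    have h3 := hA.ib3 b a
    rwa [hA.mem_designated_iff.1 hb a, ← show b = A.imp b b from hb] at h3
  change A.imp a b = A.imp (A.imp a b) (A.imp a b)
  rw [hA.imp_left_comm, h]

theorem meet_imp_left_mem (hA : A.IsImplicativeBilattice) (a b : A) :
    A.imp (A.meet a b) a ∈ A.designated := by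
  rw [← hA.imp_imp, hA.imp_left_comm]
  exact hA.imp_mem_of_mem _ (hA.imp_self_mem a)

theorem meet_imp_right_mem (hA : A.IsImplicativeBilattice) (a b : A) :
    A.imp (A.meet a b) b ∈ A.designated := by
  rw [← hA.imp_imp]
  exact hA.imp_mem_of_mem _ (hA.imp_self_mem b)

theorem imp_mem_of_leT (hA : A.IsImplicativeBilattice) {a b : A} (hab : A.LeT a b) :
    A.imp a b ∈ A.designated := by
  have := hA.meet_imp_right_mem a b
  rwa [show A.meet a b = a from hab] at this

/-- This is (IB5) with its designated antecedent erased; it is the link between implication and the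
two orders. -/
theorem leT_tensor (hA : A.IsImplicativeBilattice) {a b : A} (hab : A.imp a b ∈ A.designated) :
    A.LeT a (A.tensor a b) := by
  have := hA.ib5 a b
  rwa [hA.mem_designated_iff.1 hab] at this

theorem leT_imp_of_leT (hA : A.IsImplicativeBilattice) {a b : A} (hab : A.LeT a b) (c : A) :
    A.LeT (A.imp b c) (A.imp a c) := by
  have ht := hA.bilattice.truth_lattice
  have h := (hA.ib4 a b c).1
  rw [ht.join_eq_of_meet_eq hab, ht.meet_comm] at h
  exact h.symm

/-- By (IB2) the nested implication is (a ⊗ b) ⊃ c, and a ≤_t a ⊗ b, while ⊃ is antitone in its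
antecedent. -/
theorem imp_mem_of_imp_imp_mem (hA : A.IsImplicativeBilattice) {a b c : A}
    (hab : A.imp a b ∈ A.designated) (h : A.imp a (A.imp b c) ∈ A.designated) :
    A.imp a c ∈ A.designated := by
  rw [hA.imp_imp_tensor] at h
  exact hA.mem_of_leT h (hA.leT_imp_of_leT (hA.leT_tensor hab) c)

theorem imp_trans (hA : A.IsImplicativeBilattice) {a b c : A} (hab : A.imp a b ∈ A.designated)
    (hbc : A.imp b c ∈ A.designated) : A.imp a c ∈ A.designated :=
  hA.imp_mem_of_imp_imp_mem hab (hA.imp_mem_of_mem a hbc)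

theorem imp_distrib_mem (hA : A.IsImplicativeBilattice) (p q r : A) :
    A.imp (A.imp p (A.imp q r)) (A.imp (A.imp p q) (A.imp p r)) ∈ A.designated := by
  rw [hA.imp_imp, hA.imp_imp]
  -- The goal is now (w ∧ p) ⊃ r. From the antecedent w ∧ p one obtains p, then q, then q ⊃ r, hence
  -- r.
  set s := A.imp p (A.imp q r)
  set w := A.meet s (A.imp p q)
  have hp : A.imp (A.meet w p) p ∈ A.designated := hA.meet_imp_right_mem w p
  have hw : A.imp (A.meet w p) w ∈ A.designated := hA.meet_imp_left_mem w p
  have hq := hA.imp_mem_of_imp_imp_mem hp (hA.imp_trans hw (hA.meet_imp_right_mem s (A.imp p q)))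
  exact hA.imp_mem_of_imp_imp_mem hq (hA.imp_mem_of_imp_imp_mem hp
    (hA.imp_trans hw (hA.meet_imp_left_mem s (A.imp p q))))

/-- Strong implication determines the truth order. -/
theorem leT_of_imp_mem (hA : A.IsImplicativeBilattice) {a b : A}
    (hab : A.imp a b ∈ A.designated) (hba : A.imp (A.neg b) (A.neg a) ∈ A.designated) :
    A.LeT a b := by
  have hB := hA.bilattice
  -- The element a ⊗ b interpolates: a ≤_t a ⊗ b by the first hypothesis, and a ⊗ b ≤_t b by
  -- negating ¬b ≤_t ¬b ⊗ ¬a.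
  have h₁ := hA.leT_tensor hab
  have h₂ := hB.neg1 _ _ (hA.leT_tensor hba)
  rw [← hB.neg_tensor, ← hB.neg3, ← hB.neg3, hB.knowledge_lattice.meet_comm] at h₂
  change A.meet a b = a
  rw [← show A.meet a (A.tensor a b) = a from h₁, hB.truth_lattice.meet_assoc,
    show A.meet (A.tensor a b) b = A.tensor a b from h₂]

theorem strongIff_mem_iff (hA : A.IsImplicativeBilattice) {V : Type} (h : V → A) (φ ψ : Fm V) :
    (φ.strongIff ψ).eval A h ∈ A.designated ↔ φ.eval A h = ψ.eval A h := by
  simp only [Fm.strongIff, Fm.strongImp, Fm.eval, hA.meet_mem_designated]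
  refine ⟨fun ⟨⟨h₁, h₂⟩, h₃, h₄⟩ => hA.bilattice.truth_lattice.antisymm
    (hA.leT_of_imp_mem h₁ h₂) (hA.leT_of_imp_mem h₃ h₄), fun e => ?_⟩
  rw [e]
  exact ⟨⟨hA.imp_self_mem _, hA.imp_self_mem _⟩, hA.imp_self_mem _, hA.imp_self_mem _⟩

theorem weakEquiv_mem_of_eq (hA : A.IsImplicativeBilattice) (h : ℕ → A) {φ ψ : Fm ℕ}
    (e : φ.eval A h = ψ.eval A h) : (φ.weakEquiv ψ).eval A h ∈ A.designated := by
  simp only [Fm.weakEquiv, Fm.eval, hA.meet_mem_designated, e]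
  exact ⟨hA.imp_self_mem _, hA.imp_self_mem _⟩

theorem eval_mem_of_hAxiom (hA : A.IsImplicativeBilattice) (h : ℕ → A) {φ : Fm ℕ}
    (hφ : HAxiom φ) : φ.eval A h ∈ A.designated := by
  have hB := hA.bilattice
  cases hφ with
  | imp1 p q =>
    simp only [Fm.eval]
    rw [hA.imp_left_comm]
    exact hA.imp_mem_of_mem _ (hA.imp_self_mem _)
  | imp2 p q r => exact hA.imp_distrib_mem _ _ _
  | imp3 p q =>
    simp only [Fm.eval]
    rw [hA.ib3]
    exact hA.imp_self_mem _
  | meet_imp_left p q => exact hA.meet_imp_left_mem _ _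
  | meet_imp_right p q => exact hA.meet_imp_right_mem _ _
  | imp_meet p q =>
    simp only [Fm.eval]
    rw [hA.imp_imp]
    exact hA.imp_self_mem _
  | tensor_imp_left p q =>
    simp only [Fm.eval]
    rw [← (hA.ib2 _ _ _).2]
    exact hA.meet_imp_left_mem _ _
  | tensor_imp_right p q =>
    simp only [Fm.eval]
    rw [← (hA.ib2 _ _ _).2]
    exact hA.meet_imp_right_mem _ _
  | imp_tensor p q =>
    simp only [Fm.eval]
    rw [hA.imp_imp_tensor]
    exact hA.imp_self_mem _
  | imp_join_left p q => exact hA.imp_mem_of_leT (hB.truth_lattice.le_join_left _ _)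
  | imp_join_right p q => exact hA.imp_mem_of_leT (hB.truth_lattice.le_join_right _ _)
  | join_imp p q r =>
    simp only [Fm.eval]
    rw [hA.imp_imp, ← (hA.ib4 _ _ _).1]
    exact hA.imp_self_mem _
  | imp_plus_left p q =>
    -- (IB4) splits (p ⊕ q) ⊃ (p ⊕ q) into the meet of the two injections.
    have := hA.imp_self_mem ((p.plus q).eval A h)
    simp only [Fm.eval, ← (hA.ib4 _ _ _).2, hA.meet_mem_designated] at this
    exact this.1
  | imp_plus_right p q =>
    have := hA.imp_self_mem ((p.plus q).eval A h)
    simp only [Fm.eval, ← (hA.ib4 _ _ _).2, hA.meet_mem_designated] at this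
    exact this.2
  | plus_imp p q r =>
    simp only [Fm.eval]
    rw [hA.imp_imp, (hA.ib4 _ _ _).2]
    exact hA.imp_self_mem _
  | neg_meet p q => exact hA.weakEquiv_mem_of_eq h (hB.neg_meet _ _)
  | neg_join p q => exact hA.weakEquiv_mem_of_eq h (hB.neg_join _ _)
  | neg_tensor p q => exact hA.weakEquiv_mem_of_eq h (hB.neg_tensor _ _)
  | neg_plus p q => exact hA.weakEquiv_mem_of_eq h (hB.neg_plus _ _)
  | neg_imp p q =>
    simp only [Fm.weakEquiv, Fm.eval, hA.meet_mem_designated]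
    -- (IB6) exchanges ¬(p ⊃ q) and p ∧ ¬q only as antecedents; one use in each direction makes both
    -- implications of the form x ⊃ x.
    rw [hA.ib6, ← hA.ib6 _ _ (A.neg _)]
    exact ⟨hA.imp_self_mem _, hA.imp_self_mem _⟩
  | neg_neg p => exact hA.weakEquiv_mem_of_eq h (hB.neg3 _)

/-- The designated elements of an implicative bilattice form an `H⊃`-filter. -/
theorem matrixEntails_designated (hA : A.IsImplicativeBilattice) {Γ : Set (Fm ℕ)} {φ : Fm ℕ}
    (hφ : HDerives Γ φ) : MatrixEntails A A.designated Γ φ := by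
  intro h hΓ
  induction hφ with
  | ax φ hφ => exact hA.eval_mem_of_hAxiom h hφ
  | hyp φ hφ => exact hΓ φ hφ
  | mp φ ψ _ _ h₁ h₂ => exact hA.mem_of_imp_mem h₁ h₂

end IsImplicativeBilattice

/-! ## Soundness of the calculus for logical bilattices -/

namespace IsLogicalBilatticeImp

variable {A : BAlg.{u}} {F : Set A}

theorem mem_of_leT (hA : A.IsLogicalBilatticeImp F) {a b : A} (ha : a ∈ F) (hab : A.LeT a b) :
    b ∈ F := by
  rw [← show A.meet a b = a from hab, hA.prime.meet_mem] at ha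
  exact ha.2

theorem imp_mem (hA : A.IsLogicalBilatticeImp F) (a b : A) :
    A.imp a b ∈ F ↔ (a ∈ F → b ∈ F) := by
  obtain ⟨t, ht, hi⟩ := hA.imp_spec
  by_cases ha : a ∈ F
  · simp [(hi a b).1 ha, ha]
  · obtain ⟨c, hc⟩ := hA.prime.nonempty
    simp [(hi a b).2 ha, ha, hA.mem_of_leT hc (ht c)]

theorem neg_imp_mem (hA : A.IsLogicalBilatticeImp F) (a b : A) :
    A.neg (A.imp a b) ∈ F ↔ a ∈ F ∧ A.neg b ∈ F := by
  obtain ⟨t, ht, hi⟩ := hA.imp_spec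
  by_cases ha : a ∈ F
  · simp [(hi a b).1 ha, ha]
  · simp only [(hi a b).2 ha, ha, false_and, iff_false]
    intro hn
    -- Here ¬t is the least element of the truth order, so a bifilter containing it would be
    -- improper.
    refine hA.prime.proper (Set.eq_univ_of_forall fun c => hA.mem_of_leT hn ?_)
    rw [hA.bilattice.neg3 c]
    exact hA.bilattice.neg1 _ _ (ht _)

theorem eval_mem_of_hAxiom (hA : A.IsLogicalBilatticeImp F) (h : ℕ → A) {φ : Fm ℕ}
    (hφ : HAxiom φ) : φ.eval A h ∈ F := by
  have hB := hA.bilattice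
  cases hφ <;> simp only [Fm.weakEquiv, Fm.eval, hA.imp_mem, hA.prime.meet_mem,
    hA.prime.tensor_mem, hA.prime.join_mem, hA.prime.plus_mem, hB.neg_meet, hB.neg_join,
    hB.neg_tensor, hB.neg_plus, hA.neg_imp_mem, ← hB.neg3] <;> tauto

theorem matrixEntails (hA : A.IsLogicalBilatticeImp F) {Γ : Set (Fm ℕ)} {φ : Fm ℕ}
    (hφ : HDerives Γ φ) : MatrixEntails A F Γ φ := by
  intro h hΓ
  induction hφ with
  | ax φ hφ => exact hA.eval_mem_of_hAxiom h hφ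
  | hyp φ hφ => exact hΓ φ hφ
  | mp φ ψ _ _ h₁ h₂ => exact (hA.imp_mem _ _).1 h₂ h₁

end IsLogicalBilatticeImp

/-! ## The four-element bilattice -/

/-- Belnap's four-element bilattice with the implication `⊃`; an element is a pair of the
evidence for and the evidence against. -/
def four : BAlg.{u} where
  carrier := ULift.{u} (Bool × Bool)
  inhabited := ⟨⟨(true, true)⟩⟩
  meet a b := ⟨(a.down.1 && b.down.1, a.down.2 || b.down.2)⟩
  join a b := ⟨(a.down.1 || b.down.1, a.down.2 && b.down.2)⟩
  tensor a b := ⟨(a.down.1 && b.down.1, a.down.2 && b.down.2)⟩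
  plus a b := ⟨(a.down.1 || b.down.1, a.down.2 || b.down.2)⟩
  imp a b := ⟨(!a.down.1 || b.down.1, a.down.1 && b.down.2)⟩
  neg a := ⟨(a.down.2, a.down.1)⟩

theorem four_ext {a b : four.{u}} (h₁ : a.down.1 = b.down.1) (h₂ : a.down.2 = b.down.2) :
    a = b := ULift.ext _ _ (Prod.ext h₁ h₂)

theorem isBilattice_four : four.{u}.IsBilattice where
  truth_lattice := by
    constructor <;> rintro ⟨⟨a, a'⟩⟩ ⟨⟨b, b'⟩⟩ <;> try rintro ⟨⟨c, c'⟩⟩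
    all_goals
      apply four_ext <;> simp only [four] <;> revert a a' b b' <;> try revert c c'
    all_goals decide
  knowledge_lattice := by
    constructor <;> rintro ⟨⟨a, a'⟩⟩ ⟨⟨b, b'⟩⟩ <;> try rintro ⟨⟨c, c'⟩⟩
    all_goals
      apply four_ext <;> simp only [four] <;> revert a a' b b' <;> try revert c c'
    all_goals decide
  neg1 := by
    rintro ⟨⟨a, a'⟩⟩ ⟨⟨b, b'⟩⟩
    simp only [LeT, four, ULift.up.injEq, Prod.mk.injEq]
    revert a a' b b'
    decide
  neg2 := by
    rintro ⟨⟨a, a'⟩⟩ ⟨⟨b, b'⟩⟩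
    simp only [LeK, four, ULift.up.injEq, Prod.mk.injEq]
    revert a a' b b'
    decide
  neg3 _ := rfl

theorem isImplicativeBilattice_four : four.{u}.IsImplicativeBilattice where
  bilattice := isBilattice_four
  ib1 := by
    rintro ⟨⟨a, a'⟩⟩ ⟨⟨b, b'⟩⟩
    simp only [four, ULift.up.injEq, Prod.mk.injEq]
    revert a a' b b'
    decide
  ib2 := by
    rintro ⟨⟨a, a'⟩⟩ ⟨⟨b, b'⟩⟩ ⟨⟨c, c'⟩⟩
    simp only [four, ULift.up.injEq, Prod.mk.injEq]
    revert a a' b b' c c'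
    decide
  ib3 := by
    rintro ⟨⟨a, a'⟩⟩ ⟨⟨b, b'⟩⟩
    simp only [four, ULift.up.injEq, Prod.mk.injEq]
    revert a a' b b'
    decide
  ib4 := by
    rintro ⟨⟨a, a'⟩⟩ ⟨⟨b, b'⟩⟩ ⟨⟨c, c'⟩⟩
    simp only [four, ULift.up.injEq, Prod.mk.injEq]
    revert a a' b b' c c'
    decide
  ib5 := by
    rintro ⟨⟨a, a'⟩⟩ ⟨⟨b, b'⟩⟩
    simp only [four, ULift.up.injEq, Prod.mk.injEq]
    revert a a' b b'
    decide
  ib6 := by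
    rintro ⟨⟨a, a'⟩⟩ ⟨⟨b, b'⟩⟩ ⟨⟨c, c'⟩⟩
    simp only [four]

theorem mem_designated_four {a : four.{u}} : a ∈ four.designated ↔ a.down.1 = true := by
  obtain ⟨⟨a, a'⟩⟩ := a
  change (ULift.up (a, a') = ULift.up (!a || a, a && a')) ↔ a = true
  simp only [ULift.up.injEq, Prod.mk.injEq]
  revert a a'
  decide

theorem isLogicalBilatticeImp_four : four.{u}.IsLogicalBilatticeImp four.designated where
  bilattice := isBilattice_four
  prime :=
    { nonempty := ⟨⟨(true, true)⟩, mem_designated_four.2 rfl⟩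
      proper := fun h => by
        have : (⟨(false, true)⟩ : four.{u}) ∈ four.designated := h ▸ Set.mem_univ _
        exact Bool.noConfusion (mem_designated_four.1 this)
      meet_mem := fun a b => by simp only [mem_designated_four]; exact Bool.and_eq_true_iff
      tensor_mem := fun a b => by simp only [mem_designated_four]; exact Bool.and_eq_true_iff
      join_mem := fun a b => by simp only [mem_designated_four]; exact Bool.or_eq_true_iff
      plus_mem := fun a b => by simp only [mem_designated_four]; exact Bool.or_eq_true_iff }
  imp_spec := by
    refine ⟨⟨(true, false)⟩, ?_, ?_⟩
    · rintro ⟨⟨a, a'⟩⟩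
      simp [LeT, four]
    · intro x y
      rw [mem_designated_four]
      obtain ⟨⟨a, a'⟩⟩ := x
      obtain ⟨⟨b, b'⟩⟩ := y
      change (a = true → ULift.up (!a || b, a && b') = ULift.up (b, b')) ∧
        (¬ a = true → ULift.up (!a || b, a && b') = ULift.up (true, false))
      simp only [ULift.up.injEq, Prod.mk.injEq]
      revert a a' b b'
      decide

end BAlg

/-! ## Completeness of the calculus for the four-element bilattice -/

namespace HDerives

theorem mono {Γ Δ : Set (Fm ℕ)} (h : Γ ⊆ Δ) {φ : Fm ℕ} (hφ : HDerives Γ φ) : HDerives Δ φ :=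
  HImpLogic.cut Δ Γ φ (fun ψ hψ => .hyp ψ (h hψ)) hφ

theorem exists_finite {Γ : Set (Fm ℕ)} {φ : Fm ℕ} (hφ : HDerives Γ φ) :
    ∃ Γ₀ ⊆ Γ, Γ₀.Finite ∧ HDerives Γ₀ φ := by
  induction hφ with
  | ax φ h => exact ⟨∅, Set.empty_subset _, Set.finite_empty, .ax φ h⟩
  | hyp φ h => exact ⟨{φ}, by simpa using h, Set.finite_singleton φ, .hyp φ rfl⟩
  | mp φ ψ _ _ h₁ h₂ =>
    obtain ⟨Γ₁, hs₁, hf₁, h₁⟩ := h₁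
    obtain ⟨Γ₂, hs₂, hf₂, h₂⟩ := h₂
    exact ⟨Γ₁ ∪ Γ₂, Set.union_subset hs₁ hs₂, hf₁.union hf₂,
      .mp φ ψ (h₁.mono Set.subset_union_left) (h₂.mono Set.subset_union_right)⟩

theorem imp_of {Γ : Set (Fm ℕ)} (a : Fm ℕ) {b : Fm ℕ} (hb : HDerives Γ b) :
    HDerives Γ (a.imp b) := .mp _ _ hb (.ax _ (.imp1 b a))

theorem imp_self (Γ : Set (Fm ℕ)) (a : Fm ℕ) : HDerives Γ (a.imp a) :=
  .mp _ _ (.ax _ (.imp1 a a)) (.mp _ _ (.ax _ (.imp1 a (a.imp a))) (.ax _ (.imp2 _ _ _)))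

theorem deduction {Γ : Set (Fm ℕ)} {a b : Fm ℕ} (h : HDerives (insert a Γ) b) :
    HDerives Γ (a.imp b) := by
  induction h with
  | ax φ h => exact imp_of a (.ax φ h)
  | hyp φ h =>
    obtain rfl | h := h
    · exact imp_self Γ φ
    · exact imp_of a (.hyp φ h)
  | mp φ ψ _ _ h₁ h₂ => exact .mp _ _ h₁ (.mp _ _ h₂ (.ax _ (.imp2 _ _ _)))

/-- Lindenbaum's lemma: a theory that does not derive `φ` extends to a maximal one. -/
theorem exists_maximal {Γ : Set (Fm ℕ)} {φ : Fm ℕ} (h : ¬ HDerives Γ φ) :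
    ∃ T, Γ ⊆ T ∧ Maximal (fun T => ¬ HDerives T φ) T := by
  refine zorn_subset_nonempty {T | ¬ HDerives T φ} (fun c hc hch hne => ?_) Γ h
  refine ⟨⋃₀ c, fun hφ => ?_, fun s hs => Set.subset_sUnion_of_mem hs⟩
  suffices ∀ ψ, HDerives (⋃₀ c) ψ → ∃ s ∈ c, HDerives s ψ by
    obtain ⟨s, hs, hsφ⟩ := this φ hφ
    exact hc hs hsφ
  intro ψ hψ
  induction hψ with
  | ax ψ h =>
    obtain ⟨s, hs⟩ := hne
    exact ⟨s, hs, .ax ψ h⟩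
  | hyp ψ h =>
    obtain ⟨s, hs, hψ⟩ := h
    exact ⟨s, hs, .hyp ψ hψ⟩
  | mp a b _ _ h₁ h₂ =>
    obtain ⟨s₁, hs₁, h₁⟩ := h₁
    obtain ⟨s₂, hs₂, h₂⟩ := h₂
    rcases hch.total hs₁ hs₂ with hle | hle
    · exact ⟨s₂, hs₂, .mp a b (h₁.mono hle) h₂⟩
    · exact ⟨s₁, hs₁, .mp a b h₁ (h₂.mono hle)⟩

end HDerives

/-- A relatively maximal theory of `H⊃`. -/
structure IsPrimeTheory (T : Set (Fm ℕ)) : Prop where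
  closed : ∀ a, HDerives T a → a ∈ T
  imp_mem : ∀ a b, a ∉ T → a.imp b ∈ T
  proper : ∃ a, a ∉ T

/-- The underivable formula `φ` plays the role of falsum: by maximality and the deduction theorem, a
∉ T gives T ⊢ a ⊃ φ. -/
theorem isPrimeTheory_of_maximal {T : Set (Fm ℕ)} {φ : Fm ℕ}
    (hT : Maximal (fun T => ¬ HDerives T φ) T) : IsPrimeTheory T := by
  have hins : ∀ a, a ∉ T → HDerives T (a.imp φ) := fun a ha => by
    by_contra hn
    exact ha (hT.2 (fun h => hn h.deduction) (Set.subset_insert a T) (Set.mem_insert a T))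
  have hcl : ∀ a, HDerives T a → a ∈ T := fun a ha => by
    by_contra hn
    exact hT.1 (.mp _ _ ha (hins a hn))
  refine ⟨hcl, fun a b ha => ?_, φ, fun h => hT.1 (.hyp φ h)⟩
  by_contra hn
  -- Assuming φ ⊃ b, the chain a ⊃ φ, φ ⊃ b gives a ⊃ b, and (a ⊃ b) ⊃ φ then gives φ. Peirce's law
  -- discharges the assumption.
  refine hT.1 (.mp _ _ (HDerives.deduction ?_) (.ax _ (.imp3 φ b)))
  have hsub := Set.subset_insert (φ.imp b) T
  refine .mp _ _ (HDerives.deduction ?_) ((hins _ hn).mono hsub)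
  have hsub' := Set.subset_insert a (insert (φ.imp b) T)
  exact .mp _ _ (.mp _ _ (.hyp a (Set.mem_insert _ _)) ((hins a ha).mono (hsub.trans hsub')))
    (.hyp _ (hsub' (Set.mem_insert _ _)))

/-! ### Connectives in prime theories and the truth lemma -/

namespace IsPrimeTheory

variable {T : Set (Fm ℕ)}

theorem ax (hT : IsPrimeTheory T) {a : Fm ℕ} (ha : HAxiom a) : a ∈ T := hT.closed a (.ax a ha)

theorem mp (hT : IsPrimeTheory T) {a b : Fm ℕ} (h : a.imp b ∈ T) (ha : a ∈ T) : b ∈ T :=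
  hT.closed b (.mp a b (.hyp a ha) (.hyp _ h))

theorem imp_iff (hT : IsPrimeTheory T) (a b : Fm ℕ) : a.imp b ∈ T ↔ (a ∈ T → b ∈ T) := by
  refine ⟨hT.mp, fun h => ?_⟩
  by_cases ha : a ∈ T
  · exact hT.mp (hT.ax (.imp1 b a)) (h ha)
  · exact hT.imp_mem a b ha

theorem meet_iff (hT : IsPrimeTheory T) (a b : Fm ℕ) : a.meet b ∈ T ↔ a ∈ T ∧ b ∈ T :=
  ⟨fun h => ⟨hT.mp (hT.ax (.meet_imp_left a b)) h, hT.mp (hT.ax (.meet_imp_right a b)) h⟩,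
    fun h => hT.mp (hT.mp (hT.ax (.imp_meet a b)) h.1) h.2⟩

theorem tensor_iff (hT : IsPrimeTheory T) (a b : Fm ℕ) : a.tensor b ∈ T ↔ a ∈ T ∧ b ∈ T :=
  ⟨fun h => ⟨hT.mp (hT.ax (.tensor_imp_left a b)) h, hT.mp (hT.ax (.tensor_imp_right a b)) h⟩,
    fun h => hT.mp (hT.mp (hT.ax (.imp_tensor a b)) h.1) h.2⟩

theorem join_iff (hT : IsPrimeTheory T) (a b : Fm ℕ) : a.join b ∈ T ↔ a ∈ T ∨ b ∈ T := by
  refine ⟨fun h => ?_, fun h => h.elim (hT.mp (hT.ax (.imp_join_left a b)))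
    (hT.mp (hT.ax (.imp_join_right a b)))⟩
  by_contra! hn
  -- Any `c` outside `T` serves as falsum: a ⊃ c and b ⊃ c are in `T`, so a ∨ b would force c into
  -- `T`.
  obtain ⟨c, hc⟩ := hT.proper
  exact hc (hT.mp (hT.mp (hT.mp (hT.ax (.join_imp a b c)) (hT.imp_mem a c hn.1))
    (hT.imp_mem b c hn.2)) h)

theorem plus_iff (hT : IsPrimeTheory T) (a b : Fm ℕ) : a.plus b ∈ T ↔ a ∈ T ∨ b ∈ T := by
  refine ⟨fun h => ?_, fun h => h.elim (hT.mp (hT.ax (.imp_plus_left a b)))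
    (hT.mp (hT.ax (.imp_plus_right a b)))⟩
  by_contra! hn
  obtain ⟨c, hc⟩ := hT.proper
  exact hc (hT.mp (hT.mp (hT.mp (hT.ax (.plus_imp a b c)) (hT.imp_mem a c hn.1))
    (hT.imp_mem b c hn.2)) h)

theorem iff_of_weakEquiv (hT : IsPrimeTheory T) {a b : Fm ℕ} (h : HAxiom (a.weakEquiv b)) :
    a ∈ T ↔ b ∈ T := by
  have := hT.ax h
  rw [Fm.weakEquiv, hT.meet_iff] at this
  exact ⟨hT.mp this.1, hT.mp this.2⟩

open Classical in
/-- The valuation in the four-element bilattice given by a prime theory. -/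
noncomputable def valuation (T : Set (Fm ℕ)) (n : ℕ) : BAlg.four.{u} :=
  ⟨(decide (Fm.var n ∈ T), decide ((Fm.var n).neg ∈ T))⟩

/-- Both coordinates must be treated at once, since negation swaps them; the axioms for negated
connectives handle the second one. -/
theorem eval_valuation (hT : IsPrimeTheory T) (a : Fm ℕ) :
    ((a.eval BAlg.four.{u} (valuation T)).down.1 = true ↔ a ∈ T) ∧
    ((a.eval BAlg.four.{u} (valuation T)).down.2 = true ↔ a.neg ∈ T) := by
  induction a with
  | var n => simp [Fm.eval, valuation]
  | meet a b ha hb =>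
    rw [hT.meet_iff, hT.iff_of_weakEquiv (.neg_meet a b), hT.join_iff, ← ha.1, ← hb.1, ← ha.2,
      ← hb.2]
    exact ⟨Bool.and_eq_true_iff, Bool.or_eq_true_iff⟩
  | join a b ha hb =>
    rw [hT.join_iff, hT.iff_of_weakEquiv (.neg_join a b), hT.meet_iff, ← ha.1, ← hb.1, ← ha.2,
      ← hb.2]
    exact ⟨Bool.or_eq_true_iff, Bool.and_eq_true_iff⟩
  | tensor a b ha hb =>
    rw [hT.tensor_iff, hT.iff_of_weakEquiv (.neg_tensor a b), hT.tensor_iff, ← ha.1, ← hb.1,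
      ← ha.2, ← hb.2]
    exact ⟨Bool.and_eq_true_iff, Bool.and_eq_true_iff⟩
  | plus a b ha hb =>
    rw [hT.plus_iff, hT.iff_of_weakEquiv (.neg_plus a b), hT.plus_iff, ← ha.1, ← hb.1,
      ← ha.2, ← hb.2]
    exact ⟨Bool.or_eq_true_iff, Bool.or_eq_true_iff⟩
  | imp a b ha hb =>
    rw [hT.imp_iff, hT.iff_of_weakEquiv (.neg_imp a b), hT.meet_iff, ← ha.1, ← hb.1, ← hb.2]
    refine ⟨?_, Bool.and_eq_true_iff⟩
    refine Bool.or_eq_true_iff.trans ?_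
    rw [Bool.not_eq_true', ← Bool.not_eq_true, imp_iff_not_or]
  | neg a ha =>
    rw [← hT.iff_of_weakEquiv (.neg_neg a), ← ha.1, ← ha.2]
    exact ⟨Iff.rfl, Iff.rfl⟩

end IsPrimeTheory

/-- Completeness of `H⊃` for the four-element matrix. -/
theorem hDerives_of_matrixEntails_four {Γ : Set (Fm ℕ)} {φ : Fm ℕ}
    (h : MatrixEntails BAlg.four.{u} BAlg.four.designated Γ φ) : HDerives Γ φ := by
  by_contra hn
  obtain ⟨T, hΓT, hT⟩ := HDerives.exists_maximal hn
  have hP := isPrimeTheory_of_maximal hT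
  refine hT.1 (.hyp φ ?_)
  rw [← (hP.eval_valuation φ).1, ← BAlg.mem_designated_four]
  refine h _ fun ψ hψ => ?_
  rw [BAlg.mem_designated_four, (hP.eval_valuation ψ).1]
  exact hΓT hψ

/-- The four-element algebra has a copy in every universe, so the choice of universe for `LB⊃` does
not matter. -/
theorem lbImpLogic_entails_iff {Γ : Set (Fm ℕ)} {φ : Fm ℕ} :
    LBImpLogic.{v}.Entails Γ φ ↔ HDerives Γ φ :=
  ⟨fun h => hDerives_of_matrixEntails_four (h _ _ BAlg.isLogicalBilatticeImp_four),
    fun h _ _ hA => hA.matrixEntails h⟩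

theorem lbImpLogic_eq_hImpLogic : LBImpLogic.{v} = HImpLogic := by
  have : LBImpLogic.{v}.Entails = HImpLogic.Entails := by
    funext Γ φ
    exact propext lbImpLogic_entails_iff
  cases h : LBImpLogic.{v}
  cases h' : HImpLogic
  simp_all

/-! ## Algebraizability -/

theorem forall_mem_defEqs_tauImp_holds {A : BAlg.{u}} {h : ℕ → A} {φ : Fm ℕ} :
    (∀ e ∈ defEqs tauImp φ, FmEq.Holds e A h) ↔ φ.eval A h ∈ A.designated := by
  simp [defEqs, tauImp, FmEq.Holds, Fm.subst, Fm.eval, BAlg.designated]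

theorem forall_mem_eqvFms_deltaImp_holds {A : BAlg.{u}} (hA : A.IsImplicativeBilattice)
    {h : ℕ → A} {φ ψ : Fm ℕ} :
    (∀ e ∈ ⋃ χ ∈ eqvFms deltaImp φ ψ, defEqs tauImp χ, FmEq.Holds e A h) ↔
      φ.eval A h = ψ.eval A h := by
  have : eqvFms deltaImp φ ψ = {φ.strongIff ψ} := by
    ext χ
    simp [eqvFms, deltaImp, Fm.strongIff, Fm.strongImp, Fm.subst]
  rw [this, Set.biUnion_singleton, forall_mem_defEqs_tauImp_holds, hA.strongIff_mem_iff]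

/-- Soundness uses that designated sets are filters of the logic; the converse needs only the member
`four` of the class. -/
theorem isEquivalentAlgebraicSemantics_hImpLogic :
    IsEquivalentAlgebraicSemantics HImpLogic ImpBiLat.{u} tauImp deltaImp where
  finitary _ _ h := h.exists_finite
  entails_iff Γ φ := by
    have key : ∀ (A : BAlg.{u}) (h : ℕ → A), (∀ d ∈ ⋃ γ ∈ Γ, defEqs tauImp γ, d.Holds A h) ↔
        ∀ γ ∈ Γ, γ.eval A h ∈ A.designated := fun A h => by
      simp only [← forall_mem_defEqs_tauImp_holds, Set.mem_iUnion]
      exact ⟨fun H γ hγ e he => H e ⟨γ, hγ, he⟩, fun H e ⟨γ, hγ, he⟩ => H γ hγ e he⟩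
    constructor
    · intro hφ e he A hA h hΓ
      exact forall_mem_defEqs_tauImp_holds.2
        (BAlg.IsImplicativeBilattice.matrixEntails_designated hA hφ h ((key A h).1 hΓ)) e he
    · intro H
      refine hDerives_of_matrixEntails_four.{u} fun h hΓ => ?_
      exact forall_mem_defEqs_tauImp_holds.1 fun e he =>
        H e he _ BAlg.isImplicativeBilattice_four h ((key _ h).2 hΓ)
  eqv_of_eq φ ψ e he A hA h hd :=
    (forall_mem_eqvFms_deltaImp_holds hA).2 (hd (φ, ψ) rfl) e he
  eq_of_eqv φ ψ A hA h hd := (forall_mem_eqvFms_deltaImp_holds hA).1 hd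

/-! ### Equivalent semantics share their equational consequence -/

namespace IsEquivalentAlgebraicSemantics

variable {L : SententialLogic} {K K' : Set BAlg.{u}} {τ τ' : Finset (FmEq (Fin 1))}
  {Δ Δ' : Finset (Fm (Fin 2))}

theorem holds_iff (hK : IsEquivalentAlgebraicSemantics L K τ Δ) {A : BAlg.{u}} (hA : A ∈ K)
    (h : ℕ → A) (d : FmEq ℕ) :
    d.Holds A h ↔ ∀ χ ∈ eqvFms Δ d.1 d.2, ∀ e ∈ defEqs τ χ, FmEq.Holds e A h := by
  refine ⟨fun hd χ hχ e he => ?_, fun H => ?_⟩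
  · refine hK.eqv_of_eq d.1 d.2 e (Set.mem_biUnion hχ he) A hA h fun d' hd' => ?_
    obtain rfl : d' = d := hd'
    exact hd
  · refine hK.eq_of_eqv d.1 d.2 A hA h fun e he => ?_
    obtain ⟨χ, hχ, he⟩ := Set.mem_iUnion₂.1 he
    exact H χ hχ e he

/-- The equational consequence of an equivalent algebraic semantics, in terms of the logic. -/
theorem eqConsequence_iff (hK : IsEquivalentAlgebraicSemantics L K τ Δ) (E : Set (FmEq ℕ))
    (e : FmEq ℕ) : EqConsequence K E e ↔
      ∀ χ ∈ eqvFms Δ e.1 e.2, L.Entails (⋃ d ∈ E, eqvFms Δ d.1 d.2) χ := by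
  constructor
  · intro H χ hχ
    refine (hK.entails_iff _ χ).2 fun e' he' A hA h hE => ?_
    refine (hK.holds_iff hA h e).1 (H A hA h fun d hd => ?_) χ hχ e' he'
    exact (hK.holds_iff hA h d).2 fun χ' hχ' d' hd' =>
      hE d' (Set.mem_biUnion (Set.mem_biUnion hd hχ') hd')
  · intro H A hA h hE
    refine (hK.holds_iff hA h e).2 fun χ hχ e' he' => ?_
    refine (hK.entails_iff _ χ).1 (H χ hχ) e' he' A hA h fun d' hd' => ?_
    obtain ⟨χ', hχ', hd'⟩ := Set.mem_iUnion₂.1 hd'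
    obtain ⟨d, hd, hχ'⟩ := Set.mem_iUnion₂.1 hχ'
    exact (hK.holds_iff hA h d).1 (hE d hd) χ' hχ' d' hd'

theorem entails_eqvFms_self (hK : IsEquivalentAlgebraicSemantics L K τ Δ) {φ χ : Fm ℕ}
    (hχ : χ ∈ eqvFms Δ φ φ) : L.Entails ∅ χ :=
  (hK.entails_iff _ χ).2 fun e he _ hA h _ => (hK.holds_iff hA h (φ, φ)).1 rfl χ hχ e he

/-- Any two sets of equivalence formulas of a logic are interderivable. -/
theorem entails_eqvFms (hK : IsEquivalentAlgebraicSemantics L K τ Δ)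
    (hK' : IsEquivalentAlgebraicSemantics L K' τ' Δ') {φ ψ χ : Fm ℕ}
    (hχ : χ ∈ eqvFms Δ φ ψ) : L.Entails (eqvFms Δ' φ ψ) χ := by
  obtain ⟨δ, hδ, rfl⟩ := hχ
  refine (hK'.entails_iff _ _).2 fun e he A hA h hE => ?_
  have hφψ : φ.eval A h = ψ.eval A h := hK'.eq_of_eqv φ ψ A hA h hE
  obtain ⟨d, hd, rfl⟩ := he
  -- Algebras in `K'` satisfying the premises identify φ and ψ, so δ(φ, ψ) takes the value of the
  -- theorem δ(φ, φ).
  have hχ := hK.entails_eqvFms_self (φ := φ) ⟨δ, hδ, rfl⟩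
  have := (hK'.entails_iff _ _).1 hχ _ ⟨d, hd, rfl⟩ A hA h (by simp)
  have heq : (δ.subst ![φ, ψ]).eval A h = (δ.subst ![φ, φ]).eval A h := by
    rw [Fm.eval_subst, Fm.eval_subst]
    congr 1
    funext i
    fin_cases i
    · rfl
    · exact hφψ.symm
  simpa only [FmEq.Holds, Fm.eval_subst A h (fun _ : Fin 1 => _), heq] using this

theorem eqConsequence_of_eqConsequence (hK : IsEquivalentAlgebraicSemantics L K τ Δ)
    (hK' : IsEquivalentAlgebraicSemantics L K' τ' Δ') {E : Set (FmEq ℕ)} {e : FmEq ℕ}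
    (h : EqConsequence K E e) : EqConsequence K' E e := by
  rw [hK'.eqConsequence_iff]
  intro χ hχ
  rw [hK.eqConsequence_iff] at h
  refine L.cut _ _ χ (fun ψ hψ => ?_) (hK'.entails_eqvFms hK hχ)
  refine L.cut _ _ ψ (fun ψ' hψ' => ?_) (h ψ hψ)
  obtain ⟨d, hd, hψ'⟩ := Set.mem_iUnion₂.1 hψ'
  exact L.cut _ _ ψ' (fun θ hθ => L.refl _ θ (Set.mem_biUnion hd hθ)) (hK.entails_eqvFms hK' hψ')

end IsEquivalentAlgebraicSemantics

/-! ## The variety of implicative bilattices -/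

/-- The valuation of the variables by `a, b, c, c, …`. -/
def valuation₃ {X : Type u} (a b c : X) : ℕ → X
  | 0 => a
  | 1 => b
  | _ => c

/-- Implicative bilattices are the algebras that satisfy all identities valid in them. -/
theorem mem_impBiLat_of_identities {A : BAlg.{u}}
    (H : ∀ e : FmEq ℕ, EqConsequence ImpBiLat.{u} ∅ e → ∀ h : ℕ → A, e.Holds A h) :
    A ∈ ImpBiLat.{u} := by
  have key (φ ψ : Fm ℕ) (hv : ∀ B : BAlg.{u}, B.IsImplicativeBilattice → ∀ h : ℕ → B,
      φ.eval B h = ψ.eval B h) (a b c : A) :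
      φ.eval A (valuation₃ a b c) = ψ.eval A (valuation₃ a b c) :=
    H (φ, ψ) (fun B hB h _ => hv B hB h) _
  let x : Fm ℕ := .var 0
  let y : Fm ℕ := .var 1
  let z : Fm ℕ := .var 2
  have ht : IsLatticeOps A.meet A.join :=
    { meet_comm := fun a b =>
        key (x.meet y) (y.meet x) (fun B hB h => hB.bilattice.truth_lattice.meet_comm _ _) a b a
      meet_assoc := key ((x.meet y).meet z) (x.meet (y.meet z))
        (fun B hB h => hB.bilattice.truth_lattice.meet_assoc _ _ _)
      join_comm := fun a b =>
        key (x.join y) (y.join x) (fun B hB h => hB.bilattice.truth_lattice.join_comm _ _) a b a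
      join_assoc := key ((x.join y).join z) (x.join (y.join z))
        (fun B hB h => hB.bilattice.truth_lattice.join_assoc _ _ _)
      meet_join_self := fun a b => key (x.meet (x.join y)) x
        (fun B hB h => hB.bilattice.truth_lattice.meet_join_self _ _) a b a
      join_meet_self := fun a b => key (x.join (x.meet y)) x
        (fun B hB h => hB.bilattice.truth_lattice.join_meet_self _ _) a b a }
  have hk : IsLatticeOps A.tensor A.plus :=
    { meet_comm := fun a b => key (x.tensor y) (y.tensor x)
        (fun B hB h => hB.bilattice.knowledge_lattice.meet_comm _ _) a b a
      meet_assoc := key ((x.tensor y).tensor z) (x.tensor (y.tensor z))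
        (fun B hB h => hB.bilattice.knowledge_lattice.meet_assoc _ _ _)
      join_comm := fun a b => key (x.plus y) (y.plus x)
        (fun B hB h => hB.bilattice.knowledge_lattice.join_comm _ _) a b a
      join_assoc := key ((x.plus y).plus z) (x.plus (y.plus z))
        (fun B hB h => hB.bilattice.knowledge_lattice.join_assoc _ _ _)
      meet_join_self := fun a b => key (x.tensor (x.plus y)) x
        (fun B hB h => hB.bilattice.knowledge_lattice.meet_join_self _ _) a b a
      join_meet_self := fun a b => key (x.plus (x.tensor y)) x
        (fun B hB h => hB.bilattice.knowledge_lattice.join_meet_self _ _) a b a }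
  -- Monotonicity of negation is only a quasi-identity; these De Morgan-type laws are identities
  -- that imply it.
  have hneg_meet (a b : A) : A.neg (A.meet a b) = A.join (A.neg a) (A.neg b) :=
    key (x.meet y).neg (x.neg.join y.neg) (fun B hB h => hB.bilattice.neg_meet _ _) a b a
  have hneg_tensor (a b : A) : A.neg (A.tensor a b) = A.tensor (A.neg a) (A.neg b) :=
    key (x.tensor y).neg (x.neg.tensor y.neg) (fun B hB h => hB.bilattice.neg_tensor _ _) a b a
  exact
    { bilattice :=
        { truth_lattice := ht
          knowledge_lattice := hk
          neg1 := fun a b hab => ht.meet_eq_of_join_eq (by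
            rw [ht.join_comm, ← hneg_meet, show A.meet a b = a from hab])
          neg2 := fun a b hab => by
            change A.tensor _ _ = _
            rw [← hneg_tensor, show A.tensor a b = a from hab]
          neg3 := fun a => key x x.neg.neg (fun B hB h => hB.bilattice.neg3 _) a a a }
      ib1 := fun a b => key ((x.imp x).imp y) y (fun B hB h => hB.ib1 _ _) a b a
      ib2 := fun a b c =>
        ⟨key (x.imp (y.imp z)) ((x.meet y).imp z) (fun B hB h => (hB.ib2 _ _ _).1) a b c,
          key ((x.meet y).imp z) ((x.tensor y).imp z) (fun B hB h => (hB.ib2 _ _ _).2) a b c⟩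
      ib3 := fun a b =>
        key (((x.imp y).imp x).imp x) (x.imp x) (fun B hB h => hB.ib3 _ _) a b a
      ib4 := fun a b c =>
        ⟨key ((x.join y).imp z) ((x.imp z).meet (y.imp z))
            (fun B hB h => (hB.ib4 _ _ _).1) a b c,
          key ((x.imp z).meet (y.imp z)) ((x.plus y).imp z)
            (fun B hB h => (hB.ib4 _ _ _).2) a b c⟩
      ib5 := fun a b => key (x.meet ((x.imp y).imp (x.tensor y))) x
        (fun B hB h => hB.ib5 _ _) a b a
      ib6 := key ((x.imp y).neg.imp z) ((x.meet y.neg).imp z) (fun B hB h => hB.ib6 _ _ _) }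

theorem isVariety_impBiLat : IsVariety ImpBiLat.{u} :=
  ⟨{e | EqConsequence ImpBiLat.{u} ∅ e}, fun A =>
    ⟨fun hA _ he h => he A hA h (by simp), mem_impBiLat_of_identities⟩⟩

/-- `ImpBiLat` is the only quasivariety that is an equivalent algebraic semantics of a logic of
which it is one. -/
theorem IsQuasivariety.eq_impBiLat {L : SententialLogic} {K : Set BAlg.{u}}
    {τ τ' : Finset (FmEq (Fin 1))} {Δ Δ' : Finset (Fm (Fin 2))} (hQ : IsQuasivariety K)
    (hK : IsEquivalentAlgebraicSemantics L K τ Δ)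
    (hI : IsEquivalentAlgebraicSemantics L ImpBiLat.{u} τ' Δ') : K = ImpBiLat.{u} := by
  ext A
  constructor
  · exact fun hA => mem_impBiLat_of_identities fun e he h =>
      hI.eqConsequence_of_eqConsequence hK he A hA h (by simp)
  · obtain ⟨Q, hQ⟩ := hQ
    refine fun hA => (hQ A).2 fun q hq h hp => ?_
    have : EqConsequence K {d | d ∈ q.1} q.2 := fun B hB h' hd => (hQ B).1 hB q hq h' hd
    exact hK.eqConsequence_of_eqConsequence hI this A hA h hp

/-! ## Reduced models -/

/-- If a θ b, then b ↔ b is θ-related to a ↔ b; the former is designated, so by compatibility the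
latter is, whence a = b. -/
theorem isReduced_designated {A : BAlg.{u}} (hA : A.IsImplicativeBilattice) :
    A.IsReduced A.designated := by
  intro θ hθ hc a b hab
  have hr := hθ.equivalence.refl
  let h : ℕ → A := valuation₃ a b b
  have hb : ((Fm.var 1).strongIff (.var 1)).eval A h ∈ A.designated :=
    (hA.strongIff_mem_iff h _ _).2 rfl
  refine (hA.strongIff_mem_iff h (.var 0) (.var 1)).1 (hc _ _ ?_ hb)
  have hba := hθ.equivalence.symm hab
  have hn := hθ.neg _ _ hba
  exact hθ.meet _ _ _ _
    (hθ.meet _ _ _ _ (hθ.imp _ _ _ _ hba (hr _)) (hθ.imp _ _ _ _ (hr _) hn))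
    (hθ.meet _ _ _ _ (hθ.imp _ _ _ _ (hr _) hba) (hθ.imp _ _ _ _ hn (hr _)))

/-- The consequence holds in the four-element algebra, so completeness makes it a derivation between
↔-formulas, which every model respects. -/
theorem strongIff_mem_of_eqConsequence {A : BAlg.{u}} {F : Set A}
    (hF : HImpLogic.IsModel A F) {E : Set (FmEq ℕ)} {e : FmEq ℕ}
    (he : EqConsequence ImpBiLat.{u} E e) (h : ℕ → A)
    (hE : ∀ d ∈ E, (d.1.strongIff d.2).eval A h ∈ F) : (e.1.strongIff e.2).eval A h ∈ F := by
  refine hF ((fun d : FmEq ℕ => d.1.strongIff d.2) '' E) _ ?_ h ?_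
  · refine hDerives_of_matrixEntails_four.{u} fun h' hE' => ?_
    have hfour := BAlg.isImplicativeBilattice_four.{u}
    rw [hfour.strongIff_mem_iff]
    exact he _ hfour h' fun d hd => (hfour.strongIff_mem_iff h' _ _).1 (hE' _ ⟨d, hd, rfl⟩)
  · rintro _ ⟨d, hd, rfl⟩
    exact hE d hd

theorem strongIff_compatible {A : BAlg.{u}} {F : Set A} (hF : HImpLogic.IsModel A F) (h : ℕ → A)
    (φ ψ : Fm ℕ) (hi : (φ.strongIff ψ).eval A h ∈ F) (hφ : φ.eval A h ∈ F) :
    ψ.eval A h ∈ F := by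
  refine hF {φ, φ.strongIff ψ} ψ ?_ h (by simp [hi, hφ])
  refine hDerives_of_matrixEntails_four.{u} fun h' hE => ?_
  have hfour := BAlg.isImplicativeBilattice_four.{u}
  rw [← (hfour.strongIff_mem_iff h' φ ψ).1 (hE _ (by simp))]
  exact hE _ (by simp)

/-- The relation `a ↔ b ∈ F`. -/
def strongIffRel (A : BAlg.{u}) (F : Set A) (a b : A) : Prop :=
  ((Fm.var 0).strongIff (.var 1)).eval A (valuation₃ a b b) ∈ F

/-- The valuation of the variables by `a, b, c, d, d, …`. -/
def valuation₄ {X : Type u} (a b c d : X) : ℕ → X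
  | 0 => a
  | 1 => b
  | 2 => c
  | _ => d

theorem isCongruence_strongIffRel {A : BAlg.{u}} {F : Set A} (hF : HImpLogic.IsModel A F) :
    A.IsCongruence (strongIffRel A F) := by
  have bin (φ ψ : Fm ℕ) (hφψ : EqConsequence ImpBiLat.{u}
      {(.var 0, .var 1), (.var 2, .var 3)} (φ, ψ)) (a b c d : A) (hab : strongIffRel A F a b)
      (hcd : strongIffRel A F c d) : (φ.strongIff ψ).eval A (valuation₄ a b c d) ∈ F := by
    refine strongIff_mem_of_eqConsequence hF hφψ _ ?_
    rintro _ (rfl | rfl)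
    · exact hab
    · exact hcd
  have op (f : Fm ℕ → Fm ℕ → Fm ℕ) (hf : ∀ (B : BAlg.{u}) (h : ℕ → B),
      (Fm.var 0).eval B h = (Fm.var 1).eval B h → (Fm.var 2).eval B h = (Fm.var 3).eval B h →
        (f (.var 0) (.var 2)).eval B h = (f (.var 1) (.var 3)).eval B h) :
      EqConsequence ImpBiLat.{u} {(.var 0, .var 1), (.var 2, .var 3)}
        (f (.var 0) (.var 2), f (.var 1) (.var 3)) :=
    fun B _ h hE => hf B h (hE (.var 0, .var 1) (by simp)) (hE (.var 2, .var 3) (by simp))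
  refine ⟨⟨fun a => ?_, fun {a b} hab => ?_, fun {a b c} hab hbc => ?_⟩, fun a b c d => ?_,
    fun a b c d => ?_, fun a b c d => ?_, fun a b c d => ?_, fun a b c d => ?_, fun a b hab => ?_⟩
  · exact strongIff_mem_of_eqConsequence hF (E := ∅) (e := (.var 0, .var 0))
      (fun _ _ _ _ => rfl) (valuation₃ a a a) (by simp)
  · refine strongIff_mem_of_eqConsequence hF (E := {(.var 0, .var 1)}) (e := (.var 1, .var 0))
      (fun _ _ _ hE => (hE (.var 0, .var 1) (by simp)).symm) (valuation₃ a b b) ?_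
    rintro _ rfl
    exact hab
  · refine strongIff_mem_of_eqConsequence hF (E := {(.var 0, .var 1), (.var 1, .var 2)})
      (e := (.var 0, .var 2))
      (fun _ _ _ hE => (hE (.var 0, .var 1) (by simp)).trans (hE (.var 1, .var 2) (by simp)))
      (valuation₃ a b c) ?_
    rintro _ (rfl | rfl)
    · exact hab
    · exact hbc
  · exact bin _ _ (op .meet fun B _ h₁ h₂ => congrArg₂ B.meet h₁ h₂) a b c d
  · exact bin _ _ (op .join fun B _ h₁ h₂ => congrArg₂ B.join h₁ h₂) a b c d
  · exact bin _ _ (op .tensor fun B _ h₁ h₂ => congrArg₂ B.tensor h₁ h₂) a b c d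
  · exact bin _ _ (op .plus fun B _ h₁ h₂ => congrArg₂ B.plus h₁ h₂) a b c d
  · exact bin _ _ (op .imp fun B _ h₁ h₂ => congrArg₂ B.imp h₁ h₂) a b c d
  · exact bin _ _ (op (fun p _ => p.neg) fun B _ h₁ _ => congrArg B.neg h₁) a b a b hab hab

/-- Each identity φ ≈ ψ of the class puts φ ↔ ψ in the filter of every model; in a reduced model
this forces equality. -/
theorem algStar_hImpLogic : AlgStar.{u} HImpLogic = ImpBiLat.{u} := by
  ext A
  constructor
  · rintro ⟨F, hF, hred⟩
    refine mem_impBiLat_of_identities fun e he h => ?_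
    exact hred _ (isCongruence_strongIffRel hF)
      (fun a b hab => strongIff_compatible hF _ (.var 0) (.var 1) hab) _ _
      (strongIff_mem_of_eqConsequence hF he h (by simp))
  · exact fun hA => ⟨A.designated,
      fun _ _ => BAlg.IsImplicativeBilattice.matrixEntails_designated hA, isReduced_designated hA⟩

/-- `H⊃` and `LB⊃` are algebraizable with respect to the class of implicative bilattices, with
defining equation `p ≈ p ⊃ p` and equivalence formula `p ↔ q`; this class is a variety, it is the
only quasivariety that is an equivalent algebraic semantics of `LB⊃`, under any choice of defining
equations and equivalence formulas, and it is `Alg* LB⊃`. -/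
theorem theoremt :
    IsEquivalentAlgebraicSemantics HImpLogic ImpBiLat.{u} tauImp deltaImp ∧
    IsEquivalentAlgebraicSemantics LBImpLogic.{v} ImpBiLat.{u} tauImp deltaImp ∧
    IsVariety ImpBiLat.{u} ∧
    (∀ K : Set BAlg.{u}, IsQuasivariety K →
      (∃ (τ : Finset (FmEq (Fin 1))) (Δ : Finset (Fm (Fin 2))),
        IsEquivalentAlgebraicSemantics LBImpLogic.{v} K τ Δ) →
      K = ImpBiLat.{u}) ∧
    AlgStar.{u} LBImpLogic.{v} = ImpBiLat.{u} := by
  rw [lbImpLogic_eq_hImpLogic]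
  exact ⟨isEquivalentAlgebraicSemantics_hImpLogic, isEquivalentAlgebraicSemantics_hImpLogic,
    isVariety_impBiLat,
    fun _ hQ ⟨_, _, hK⟩ => hQ.eq_impBiLat hK isEquivalentAlgebraicSemantics_hImpLogic,
    algStar_hImpLogic⟩
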